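/- Let $p$ be an odd prime. Call a subset $A$ of the group $\mathbb{Z}_{p^2}$ of integers modulo $p^2$ a digit set if $|A| = p$ and the elements of $A$ are pairwise distinct modulo $p$. Put $A' = \{-(p-1)/2, -(p-3)/2, \ldots, (p-1)/2\} \subset \mathbb{Z}_{p^2}$ (the balanced digits), and let $k$ be a positive integer. (1) For every digit set $A$, the number of $k$-tuples $(a_1, \ldots, a_k) \in A^k$ with $a_1 + \cdots + a_k \pmod{p^2} \notin A$ is at least the number of $k$-tuples $(a_1, \ldots, a_k) \in (A')^k$ with $a_1 + \cdots + a_k \pmod{p^2} \notin A'$. (2) For a digit set $A$, define its carry probability for $k$ summands to be the probability that $X_1 + \cdots + X_k \pmod{p^2} \notin A$, where $X_1, \ldots, X_k$ are independent and uniformly distributed on $A$. Then $A'$ is a digit set, and its carry probability is the minimum of the carry probabilities for $k$ summands over all digit sets $A$. -/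

import Mathlib

/-- `A` is a digit set in base `p` inside the cyclic group of integers modulo `p ^ 2`: it has `p`
elements, and they are pairwise distinct modulo `p`. -/
def IsDigitSet (p : ℕ) (A : Finset (ZMod (p ^ 2))) : Prop :=
  A.card = p ∧
    Set.InjOn (ZMod.castHom (dvd_pow_self p two_ne_zero) (ZMod p)) (A : Set (ZMod (p ^ 2)))

/-- The balanced digits `-(p-1)/2, …, (p-1)/2` modulo `p ^ 2` (used for odd `p`, for which the
integer division is exact). -/
noncomputable def balancedDigits (p : ℕ) : Finset (ZMod (p ^ 2)) :=
  (Finset.Icc (-(((p : ℤ) - 1) / 2)) (((p : ℤ) - 1) / 2)).image (fun z : ℤ => (z : ZMod (p ^ 2)))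

/-- The number of ordered sums `a₁ + ⋯ + aₖ` (that is, of `k`-tuples of elements of `A`) whose
value modulo `p ^ 2` does not belong to `A`. -/
def carryCount (p k : ℕ) (A : Finset (ZMod (p ^ 2))) : ℕ :=
  ((Fintype.piFinset (fun _ : Fin k => A)).filter (fun a => ∑ i, a i ∉ A)).card

/-- The probability of carry when adding `k` independent digits, each uniformly distributed on `A`:
the probability that their sum modulo `p ^ 2` does not belong to `A`. -/
noncomputable def carryProb (p k : ℕ) (A : Finset (ZMod (p ^ 2))) : ENNReal :=
  MeasureTheory.Measure.pi
    (fun _ : Fin k => ProbabilityTheory.uniformOn (A : Set (ZMod (p ^ 2))))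
    {a | ∑ i, a i ∉ A}

/-! Minimizing carries means maximizing the number of tuples whose sum stays in A. That number is
the value at 0 of the k-fold iterate of f ↦ `shiftSum A f`, started at the indicator of A. Distinct
digits differ by units, so every nonzero difference generates the group and Pollard's inequality
(`pollard_min`) holds as in prime order. Centred segments attain it (`sum_min_repCount_initSeg`), so
their representation counts are the most concentrated (`centredMajorizes_repCount`).

A layer-cake rearrangement argument (`CentredMajorizes.sum_mul_le`) carries this majorization
through each shift. After k shifts, testing it on {0} compares the two counts, the balanced digits
being the centred segment of length p. -/

section

open Finset

/-- The number of ways to write `x` as a sum of an element of `F` and an element of `B`. -/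
def repCount {G : Type*} [AddCommGroup G] [DecidableEq G] (F B : Finset G) (x : G) : ℕ :=
  #{b ∈ B | x - b ∈ F}

/-! ### Pollard's inequality for sets with generating differences -/

section Pollard

variable {G : Type*} [AddCommGroup G] [DecidableEq G]

theorem repCount_comm (F B : Finset G) (x : G) : repCount F B x = repCount B F x := by
  apply Finset.card_nbij' (fun b => x - b) (fun b => x - b) <;> intro b <;> simp +contextual

theorem repCount_le_right (F B : Finset G) (x : G) : repCount F B x ≤ #B :=
  card_filter_le _ _

theorem repCount_le_left (F B : Finset G) (x : G) : repCount F B x ≤ #F :=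
  repCount_comm F B x ▸ repCount_le_right B F x

theorem sum_repCount [Fintype G] (F B : Finset G) : ∑ x, repCount F B x = #F * #B := by
  simp only [repCount, card_filter]
  rw [sum_comm]
  have (b : G) : ∑ x, (if x - b ∈ F then 1 else 0) = #F := by
    rw [← Equiv.sum_comp (Equiv.addRight b)]
    simp
  simp [this, mul_comm]

theorem repCount_union_right (F : Finset G) {B C : Finset G} (h : Disjoint B C) (x : G) :
    repCount F (B ∪ C) x = repCount F B x + repCount F C x := by
  simp only [repCount, card_filter, sum_union h]

theorem repCount_union_left {F H : Finset G} (h : Disjoint F H) (B : Finset G) (x : G) :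
    repCount (F ∪ H) B x = repCount F B x + repCount H B x := by
  simp only [repCount_comm _ B, repCount_union_right B h]

theorem repCount_mono_left {F H : Finset G} (h : F ⊆ H) (B : Finset G) (x : G) :
    repCount F B x ≤ repCount H B x :=
  card_le_card (monotone_filter_right _ fun _ _ hb => h hb)

/-- Swapping summands turns (F ∩ B) + (B \ F) into (B \ F) + (F ∩ B), which joins F + (F ∩ B) to
give (F ∪ B) + (F ∩ B). -/
theorem repCount_eq_union_inter (F B : Finset G) (x : G) :
    repCount F B x = repCount (F ∪ B) (F ∩ B) x + repCount (F \ B) (B \ F) x := by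
  have h1 : repCount F B x = repCount F (F ∩ B) x + repCount F (B \ F) x := by
    rw [← repCount_union_right]
    · congr 1; ext; simp; tauto
    · exact disjoint_left.2 (by simp +contextual)
  have h2 : repCount F (B \ F) x = repCount (F ∩ B) (B \ F) x + repCount (F \ B) (B \ F) x := by
    rw [← repCount_union_left]
    · congr 1; ext; simp; tauto
    · exact disjoint_left.2 (by simp +contextual)
  have h3 : repCount (F ∪ B) (F ∩ B) x = repCount F (F ∩ B) x + repCount (B \ F) (F ∩ B) x := by
    rw [← repCount_union_left]
    · congr 1; ext; simp
    · exact disjoint_left.2 (by simp +contextual)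
  rw [h1, h2, h3, repCount_comm (B \ F)]
  ring

theorem repCount_map_addRight (F B : Finset G) (c x : G) :
    repCount (F.map (Equiv.addRight c).toEmbedding) B x = repCount F B (x - c) := by
  unfold repCount
  congr 1
  ext b
  simp only [mem_filter, mem_map_equiv, Equiv.addRight_symm, Equiv.coe_addRight]
  rw [show x - c - b = x - b + -c by abel]

/-- A nonempty proper subset of a group is not stable under translation by a generator. -/
theorem exists_mem_add_notMem [Finite G] {d : G} (hd : AddSubgroup.zmultiples d = ⊤)
    {F : Finset G} (hF : F.Nonempty) (hF' : ∃ x, x ∉ F) : ∃ a ∈ F, a + d ∉ F := by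
  by_contra! h
  obtain ⟨a, ha⟩ := hF
  obtain ⟨x, hx⟩ := hF'
  have hn (n : ℕ) : a + n • d ∈ F := by
    induction n with
    | zero => simpa
    | succ n ih => rw [succ_nsmul, ← add_assoc]; exact h _ ih
  have hm : x - a ∈ AddSubgroup.zmultiples d := hd ▸ AddSubgroup.mem_top _
  rw [← mem_multiples_iff_mem_zmultiples] at hm
  obtain ⟨n, hn'⟩ := hm
  apply hx
  have := hn n
  simp only at hn'
  rwa [hn', add_sub_cancel] at this

/-- Pollard's inequality for a set `B` all of whose nonzero differences generate the group. -/
theorem pollard [Fintype G] (n : ℕ) : ∀ (F B : Finset G) (s : ℕ), #B = n →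
    (∀ b ∈ B, ∀ c ∈ B, b ≠ c → AddSubgroup.zmultiples (c - b) = ⊤) →
    s ≤ #F → s ≤ #B → #F + #B ≤ Fintype.card G + s →
    s * (#F + #B) ≤ ∑ x, min s (repCount F B x) + s * s := by
  induction n using Nat.strong_induction_on with
  | _ n ih =>
  intro F B s hn hB hsF hsB hm
  rcases Nat.eq_zero_or_pos s with rfl | hs
  · simp
  rcases hsB.eq_or_lt with hsB' | hsB'
  · have : ∀ x, min s (repCount F B x) = repCount F B x := fun x =>
      min_eq_right (hsB' ▸ repCount_le_right F B x)
    simp only [this, sum_repCount, ← hsB']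
    apply le_of_eq; ring
  rcases hsF.eq_or_lt with hsF' | hsF'
  · have : ∀ x, min s (repCount F B x) = repCount F B x := fun x =>
      min_eq_right (hsF' ▸ repCount_le_left F B x)
    simp only [this, sum_repCount, ← hsF']
    apply le_of_eq; ring
  obtain ⟨b, hb, c, hc, hbc⟩ := one_lt_card.1 (show 1 < #B by omega)
  obtain ⟨a, haF, ha⟩ := exists_mem_add_notMem (hB b hb c hc hbc)
    (card_pos.1 (show 0 < #F by omega)) (by
      by_contra! h
      have := card_eq_iff_eq_univ F |>.2 (eq_univ_of_forall h)
      omega)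
  -- This translate contains b but not c, so it meets B in a nonempty proper subset and induction on
  -- #B applies.
  let H := F.map (Equiv.addRight (b - a)).toEmbedding
  have hsum : ∑ x, min s (repCount F B x) = ∑ x, min s (repCount H B x) := by
    simp only [H, repCount_map_addRight]
    exact (Equiv.sum_comp (Equiv.subRight (b - a)) fun x => min s (repCount F B x)).symm
  have hHF : #H = #F := card_map _
  have hbH : b ∈ H := by simp [H, mem_map_equiv, haF]
  have hcH : c ∉ H := by
    simp only [H, mem_map_equiv, Equiv.addRight_symm, Equiv.coe_addRight]
    rwa [show c + -(b - a) = a + (c - b) by abel]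
  rw [hsum, ← hHF]
  rw [← hHF] at hsF hsF' hm
  clear_value H
  have hI : #(H ∩ B) < #B := card_lt_card ⟨inter_subset_right, fun h => hcH (mem_inter.1 (h hc)).1⟩
  have hI0 : 0 < #(H ∩ B) := card_pos.2 ⟨b, mem_inter.2 ⟨hbH, hb⟩⟩
  have hUI : #(H ∪ B) + #(H ∩ B) = #H + #B := card_union_add_card_inter H B
  have hH1 : #(H \ B) + #(H ∩ B) = #H := card_sdiff_add_card_inter H B
  have hB1 : #(B \ H) + #(H ∩ B) = #B := inter_comm H B ▸ card_sdiff_add_card_inter B H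
  rcases le_or_gt s #(H ∩ B) with hsI | hsI
  · have := ih #(H ∩ B) (hn ▸ hI) (H ∪ B) (H ∩ B) s rfl
      (fun x hx y hy => hB x (mem_inter.1 hx).2 y (mem_inter.1 hy).2) (by omega) hsI (by omega)
    rw [hUI] at this
    refine this.trans (Nat.add_le_add_right (sum_le_sum fun x _ => ?_) _)
    rw [repCount_eq_union_inter H B x]
    omega
  -- Counts for the union and intersection never exceed #(H ∩ B) < s, so they survive truncation
  -- whole; the remaining u + 1 is the level for the two differences.
  · obtain ⟨u, rfl⟩ := Nat.exists_eq_add_of_lt hsI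
    have h2 := ih #(B \ H) (by omega) (H \ B) (B \ H) (u + 1) rfl
      (fun x hx y hy => hB x (mem_sdiff.1 hx).1 y (mem_sdiff.1 hy).1)
      (by omega) (by omega) (by omega)
    have h1 := sum_repCount (H ∪ B) (H ∩ B)
    have h3 : ∑ x, repCount (H ∪ B) (H ∩ B) x + ∑ x, min (u + 1) (repCount (H \ B) (B \ H) x) ≤
        ∑ x, min (#(H ∩ B) + u + 1) (repCount H B x) := by
      rw [← sum_add_distrib]
      refine sum_le_sum fun x _ => ?_
      have := repCount_le_right (H ∪ B) (H ∩ B) x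
      rw [repCount_eq_union_inter H B x]
      omega
    have h4 : #(H ∪ B) = #(H \ B) + #(B \ H) + #(H ∩ B) := by omega
    rw [h1, h4] at h3
    rw [← hH1, ← hB1]
    nlinarith

/-- Pollard's inequality, with no restriction on the sizes of the two sets. -/
theorem pollard_min [Fintype G] {F B : Finset G} {s : ℕ}
    (hB : ∀ b ∈ B, ∀ c ∈ B, b ≠ c → AddSubgroup.zmultiples (c - b) = ⊤)
    (hsF : s ≤ #F) (hsB : s ≤ #B) :
    s * min (Fintype.card G) (#F + #B - s) ≤ ∑ x, min s (repCount F B x) := by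
  have key (H : Finset G) (hs : s ≤ #H) (hm : #H + #B ≤ Fintype.card G + s) :
      s * (#H + #B - s) ≤ ∑ x, min s (repCount H B x) := by
    have := pollard _ H B s rfl hB hs hsB hm
    rw [Nat.mul_sub]
    omega
  rcases le_or_gt (#F + #B) (Fintype.card G + s) with h | h
  · rw [min_eq_right (by omega)]
    exact key F hsF h
  · have hBG : #B ≤ Fintype.card G := card_le_univ B
    -- Shrinking F to this size puts the pair at the boundary case of `pollard`.
    obtain ⟨H, hHF, hH⟩ := exists_subset_card_eq (show Fintype.card G + s - #B ≤ #F by omega)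
    have := key H (by omega) (by omega)
    rw [min_eq_left (by omega)]
    rw [show #H + #B - s = Fintype.card G by omega] at this
    exact this.trans (sum_le_sum fun x _ => min_le_min_left _ (repCount_mono_left hHF B x))

end Pollard

/-! ### Centred segments and functions decreasing away from the centre -/

section CentredRank

variable {m : ℕ} [NeZero m]

/-- The position of a residue in the enumeration `0, 1, -1, 2, -2, …`. -/
def centredRank {m : ℕ} (x : ZMod m) : ℕ :=
  if 0 < x.valMinAbs then 2 * x.valMinAbs.natAbs - 1 else 2 * x.valMinAbs.natAbs

/-- The first `n` residues in the enumeration `0, 1, -1, 2, -2, …`. -/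
def initSeg (m n : ℕ) [NeZero m] : Finset (ZMod m) := {x | centredRank x < n}

theorem mem_initSeg {n : ℕ} {x : ZMod m} : x ∈ initSeg m n ↔ centredRank x < n := by
  simp [initSeg]

theorem valMinAbs_two_mul_lt (hm : Odd m) (x : ZMod m) :
    -(m : ℤ) < 2 * x.valMinAbs ∧ 2 * x.valMinAbs < m := by
  have := x.valMinAbs_mem_Ioc
  obtain ⟨r, rfl⟩ := hm
  simp only [Set.mem_Ioc] at this
  push_cast at *
  omega

theorem centredRank_lt (hm : Odd m) (x : ZMod m) : centredRank x < m := by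
  have := valMinAbs_two_mul_lt hm x
  unfold centredRank
  split_ifs <;> omega

theorem centredRank_injective {m : ℕ} : Function.Injective (centredRank : ZMod m → ℕ) := by
  intro x y h
  rw [← ZMod.valMinAbs_inj]
  unfold centredRank at h
  split_ifs at h <;> omega

theorem valMinAbs_intCast {z : ℤ} (h1 : -(m : ℤ) < 2 * z) (h2 : 2 * z < m) :
    (z : ZMod m).valMinAbs = z :=
  (ZMod.valMinAbs_spec _ _).2 ⟨rfl, by simp only [Set.mem_Ioc]; omega⟩

/-- `centredRank` as a bijection onto `{0, …, m - 1}`. -/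
noncomputable def centredRankEquiv (hm : Odd m) : ZMod m ≃ Fin m :=
  Equiv.ofBijective (fun x => ⟨centredRank x, centredRank_lt hm x⟩) <| by
    rw [Fintype.bijective_iff_injective_and_card]
    exact ⟨fun x y h => centredRank_injective (Fin.mk.inj h), by simp [ZMod.card]⟩

theorem card_initSeg (hm : Odd m) {n : ℕ} (hn : n ≤ m) : #(initSeg m n) = n := by
  have : #(initSeg m n) = #{i : Fin m | i.val < n} :=
    card_equiv (centredRankEquiv hm) fun x => by simp [mem_initSeg, centredRankEquiv]
  rw [this, Fin.card_filter_val_lt, min_eq_right hn]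

theorem intCast_mem_initSeg (hm : Odd m) {n : ℕ} (hn : n ≤ m) {i : ℕ} (hi : i < n) :
    (((i : ℤ) - ((n - 1) / 2 : ℕ) : ℤ) : ZMod m) ∈ initSeg m n := by
  obtain ⟨r, rfl⟩ := hm
  rw [mem_initSeg, centredRank, valMinAbs_intCast (by omega) (by omega)]
  split_ifs <;> omega

theorem neg_mem_initSeg (hm : Odd m) {q : ℕ} (hq : Odd q) {x : ZMod m} (hx : x ∈ initSeg m q) :
    -x ∈ initSeg m q := by
  have h : (-x).valMinAbs = -x.valMinAbs := by
    have := valMinAbs_two_mul_lt hm x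
    rw [ZMod.valMinAbs_spec]
    refine ⟨by simp, ?_⟩
    simp only [Set.mem_Ioc]
    omega
  rw [mem_initSeg, centredRank] at *
  obtain ⟨r, rfl⟩ := hq
  rw [h]
  split_ifs at * <;> omega

theorem initSeg_eq_image (hm : Odd m) {h : ℕ} (hq : 2 * h + 1 ≤ m) :
    initSeg m (2 * h + 1) = (Finset.Icc (-(h : ℤ)) h).image fun z : ℤ => (z : ZMod m) := by
  ext x
  simp only [mem_image, mem_Icc, mem_initSeg]
  constructor
  · intro hx
    refine ⟨x.valMinAbs, ?_, x.coe_valMinAbs⟩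
    unfold centredRank at hx
    split_ifs at hx <;> omega
  · rintro ⟨z, hz, rfl⟩
    obtain ⟨r, rfl⟩ := hm
    rw [centredRank, valMinAbs_intCast (by push_cast; omega) (by push_cast; omega)]
    split_ifs <;> omega

/-- The reversed form of Pollard's inequality for two centred segments. -/
theorem sum_min_repCount_initSeg (hm : Odd m) {n q s : ℕ} (hn : n ≤ m) (hq : q ≤ m)
    (hqo : Odd q) :
    (n - s) * (q - s) + ∑ x, min s (repCount (initSeg m n) (initSeg m q) x) ≤ n * q := by
  let c (i : ℕ) : ZMod m := (((i : ℤ) - ((n - 1) / 2 : ℕ) : ℤ) : ZMod m)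
  -- This progression runs backwards, so raising both indices together preserves c i + a j.
  let a (j : ℕ) : ZMod m := -(((j : ℤ) - ((q - 1) / 2 : ℕ) : ℤ) : ZMod m)
  have hc (i) (hi : i < n) : c i ∈ initSeg m n := intCast_mem_initSeg hm hn hi
  have ha (j) (hj : j < q) : a j ∈ initSeg m q :=
    neg_mem_initSeg hm hqo (intCast_mem_initSeg hm hq hj)
  have hinj (i j : ℕ) (hi : i < m) (hj : j < m) (h : (i : ZMod m) = j) : i = j := by
    rwa [ZMod.natCast_eq_natCast_iff', Nat.mod_eq_of_lt hi, Nat.mod_eq_of_lt hj] at h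
  have hcinj (i j) (hi : i < n) (hj : j < n) (h : c i = c j) : i = j :=
    hinj i j (by omega) (by omega) (by simpa [c] using h)
  have hainj (i j) (hi : i < q) (hj : j < q) (h : a i = a j) : i = j :=
    hinj i j (by omega) (by omega) (by simpa [a] using h)
  have hstep (i j k : ℕ) : c (i + k) + a (j + k) = c i + a j := by
    simp only [c, a]; push_cast; ring
  let Q (x : ZMod m) : Finset (ℕ × ℕ) :=
    {ij ∈ range (n - s) ×ˢ range (q - s) | c ij.1 + a ij.2 = x}
  have hP (x : ZMod m) (P : Finset (ℕ × ℕ))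
      (h : ∀ ij ∈ P, ij.1 < n ∧ ij.2 < q ∧ c ij.1 + a ij.2 = x) :
      #P ≤ repCount (initSeg m n) (initSeg m q) x := by
    refine card_le_card_of_injOn (fun ij => a ij.2) ?_ ?_
    · intro ij hij
      obtain ⟨h1, h2, h3⟩ := h ij hij
      simp only [coe_filter, Set.mem_ofPred_eq]
      refine ⟨ha _ h2, ?_⟩
      rw [← h3, add_sub_cancel_right]
      exact hc _ h1
    · intro u hu v hv huv
      obtain ⟨h1, h2, h3⟩ := h u hu
      obtain ⟨h1', h2', h3'⟩ := h v hv
      have e2 : u.2 = v.2 := hainj _ _ h2 h2' huv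
      have e1 : c u.1 = c v.1 := by
        rw [← h3', e2] at h3
        exact add_right_cancel h3
      exact Prod.ext (hcinj _ _ h1 h1' e1) e2
  have hQ (x : ZMod m) : #(Q x) + min s (repCount (initSeg m n) (initSeg m q) x) ≤
      repCount (initSeg m n) (initSeg m q) x := by
    rcases (Q x).eq_empty_or_nonempty with h0 | h0
    · simp [h0]
    suffices h : #(Q x) + s ≤ repCount (initSeg m n) (initSeg m q) x by omega
    -- From the pair with largest first index, s more diagonal steps stay in the n × q box and give
    -- s new representations of x.
    obtain ⟨u, hu, humax⟩ := exists_max_image (Q x) (fun ij => ij.1) h0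
    have hdisj : Disjoint (Q x) ((range s).image fun k => (u.1 + (k + 1), u.2 + (k + 1))) := by
      rw [disjoint_left]
      intro v hv hv'
      simp only [mem_image] at hv'
      obtain ⟨k, -, rfl⟩ := hv'
      have := humax _ hv
      simp only at this
      omega
    have hcard : #((range s).image fun k => (u.1 + (k + 1), u.2 + (k + 1))) = s := by
      rw [card_image_of_injective _ (fun k l h => by simpa using h), card_range]
    nth_rw 1 [← hcard]
    rw [← card_union_of_disjoint hdisj]
    apply hP
    simp only [Q, mem_filter, mem_product, mem_range] at hu
    intro v hv
    rcases mem_union.1 hv with hv | hv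
    · simp only [Q, mem_filter, mem_product, mem_range] at hv
      exact ⟨by omega, by omega, hv.2⟩
    · simp only [mem_image, mem_range] at hv
      obtain ⟨k, hk, rfl⟩ := hv
      exact ⟨by simp only; omega, by simp only; omega, by simp only; rw [hstep]; exact hu.2⟩
  have hsum : ∑ x, #(Q x) = (n - s) * (q - s) := by
    rw [← card_eq_sum_card_fiberwise (fun _ _ => by simp)]
    simp
  calc _ = ∑ x, (#(Q x) + min s (repCount (initSeg m n) (initSeg m q) x)) := by
        rw [sum_add_distrib, hsum]
    _ ≤ ∑ x, repCount (initSeg m n) (initSeg m q) x := sum_le_sum fun x _ => hQ x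
    _ = n * q := by rw [sum_repCount, card_initSeg hm hn, card_initSeg hm hq]

/-- A function on residues that decreases along `0, 1, -1, 2, -2, …`. -/
def CentredDecreasing (g : ZMod m → ℕ) : Prop :=
  ∀ x y, centredRank x ≤ centredRank y → g y ≤ g x

/-- The correlation of `f` with the indicator function of `A`. -/
def shiftSum (A : Finset (ZMod m)) (f : ZMod m → ℕ) (x : ZMod m) : ℕ := ∑ a ∈ A, f (x + a)

-- The reflection w ↦ x + y - w of the circle swaps x and y. The point w is nearer to x than to y,
-- hence on the same side of the axis as the centre, and reflecting it can only increase its rank.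
set_option maxHeartbeats 1000000 in
theorem centredRank_reflection_le (hm : Odd m) {h : ℕ} {x y w : ZMod m}
    (hxy : centredRank x ≤ centredRank y) (hw : w - x ∈ initSeg m (2 * h + 1))
    (hw' : y - w ∉ initSeg m (2 * h + 1)) : centredRank w ≤ centredRank (x + y - w) := by
  have hd (u v w : ZMod m) (huv : u = v + w) : ∃ j : ℤ, (j = -1 ∨ j = 0 ∨ j = 1) ∧
      u.valMinAbs = v.valMinAbs + w.valMinAbs + j * m := by
    have h0 : ((u.valMinAbs - (v.valMinAbs + w.valMinAbs) : ℤ) : ZMod m) = 0 := by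
      push_cast; simp [huv]
    rw [ZMod.intCast_zmod_eq_zero_iff_dvd] at h0
    obtain ⟨j, hj⟩ := h0
    refine ⟨j, ?_, by linarith⟩
    have h1 := valMinAbs_two_mul_lt hm u
    have h2 := valMinAbs_two_mul_lt hm v
    have h3 := valMinAbs_two_mul_lt hm w
    have h4 : -2 < j := by nlinarith
    have h5 : j < 2 := by nlinarith
    omega
  obtain ⟨j1, hj1, e1⟩ := hd w (w - x) x (by abel)
  obtain ⟨j2, hj2, e2⟩ := hd y (y - w) w (by abel)
  obtain ⟨j3, hj3, e3⟩ := hd (x + y - w) (y - w) x (by abel)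
  have h1 := valMinAbs_two_mul_lt hm w
  have h2 := valMinAbs_two_mul_lt hm x
  have h3 := valMinAbs_two_mul_lt hm y
  have h4 := valMinAbs_two_mul_lt hm (w - x)
  have h5 := valMinAbs_two_mul_lt hm (y - w)
  have h6 := valMinAbs_two_mul_lt hm (x + y - w)
  simp only [mem_initSeg, centredRank] at *
  generalize (x + y - w).valMinAbs = r at *
  generalize (w - x).valMinAbs = d at *
  generalize (y - w).valMinAbs = d' at *
  generalize x.valMinAbs = vx at *
  generalize y.valMinAbs = vy at *
  generalize w.valMinAbs = vw at *
  have hd : -(h : ℤ) ≤ d ∧ d ≤ h := by split_ifs at hw <;> omega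
  have hd' : d' < -(h : ℤ) ∨ (h : ℤ) < d' := by split_ifs at hw' <;> omega
  clear hw hw'
  obtain ⟨t, rfl⟩ := hm
  -- `centredRank` orders representatives by distance to 1/4, so the comparison reads (vy - vx)(vx +
  -- vy - 1/2) ≥ 0.
  have hxy' : (vx ≤ vy ∧ 1 ≤ vx + vy) ∨ (vy ≤ vx ∧ vx + vy ≤ 0) ∨ vx = vy := by
    split_ifs at hxy <;> omega
  clear hxy
  suffices (vw ≤ r ∧ 1 ≤ vw + r) ∨ (r ≤ vw ∧ vw + r ≤ 0) ∨ vw = r by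
    clear e1 e2 e3 hxy'
    split_ifs <;> omega
  rcases hj1 with rfl | rfl | rfl <;> rcases hj2 with rfl | rfl | rfl <;>
    rcases hj3 with rfl | rfl | rfl <;> rcases hxy' with h | h | h <;> omega

/-- By symmetry of the segment A, the sum at y runs over y - A. Points common to x + A and y - A
cancel; each other x + a is paired with its reflection y - a. -/
theorem CentredDecreasing.shiftSum (hm : Odd m) {h : ℕ} {g : ZMod m → ℕ}
    (hg : CentredDecreasing g) : CentredDecreasing (shiftSum (initSeg m (2 * h + 1)) g) := by
  intro x y hxy
  set A := initSeg m (2 * h + 1)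
  have h1 : _root_.shiftSum A g y = ∑ a ∈ A, g (y - a) := by
    have hneg {a} (ha : a ∈ A) : -a ∈ A := neg_mem_initSeg hm ⟨h, rfl⟩ ha
    exact sum_nbij' (fun a => -a) (fun a => -a) (fun _ => hneg) (fun _ => hneg)
      (by simp) (by simp) (by simp)
  rw [h1, _root_.shiftSum, ← sum_filter_add_sum_filter_not A (fun a => y - x - a ∈ A),
    ← sum_filter_add_sum_filter_not A (fun a => y - x - a ∈ A) (fun a => g (x + a))]
  refine add_le_add (le_of_eq ?_) (sum_le_sum fun a ha => hg _ _ ?_)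
  · refine sum_nbij' (fun a => y - x - a) (fun a => y - x - a) ?_ ?_ ?_ ?_ ?_ <;> intro a <;>
      simp +contextual
    rw [show x + (y - x - a) = y - a by abel]
    simp
  · have := mem_filter.1 ha
    have := centredRank_reflection_le hm (w := x + a) hxy (by simpa using this.1)
      (by rw [← sub_sub]; exact this.2)
    rwa [show x + y - (x + a) = y - a by abel] at this

theorem repCount_initSeg_eq_shiftSum (hm : Odd m) (h n : ℕ) (x : ZMod m) :
    repCount (initSeg m n) (initSeg m (2 * h + 1)) x =
      shiftSum (initSeg m (2 * h + 1)) (fun y => if y ∈ initSeg m n then 1 else 0) x := by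
  have hneg {a} (ha : a ∈ initSeg m (2 * h + 1)) : -a ∈ initSeg m (2 * h + 1) :=
    neg_mem_initSeg hm ⟨h, rfl⟩ ha
  rw [repCount, card_filter]
  exact sum_nbij' (fun a => -a) (fun a => -a) (fun _ => hneg) (fun _ => hneg)
    (by simp) (by simp) (by simp [sub_eq_add_neg])

theorem centredDecreasing_indicator (n : ℕ) :
    CentredDecreasing (fun y : ZMod m => if y ∈ initSeg m n then 1 else 0) := by
  intro x y hxy
  simp only [mem_initSeg]
  split_ifs <;> omega

theorem centredDecreasing_repCount (hm : Odd m) (h n : ℕ) :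
    CentredDecreasing (repCount (initSeg m n) (initSeg m (2 * h + 1))) := by
  rw [funext (repCount_initSeg_eq_shiftSum hm h n)]
  exact (centredDecreasing_indicator n).shiftSum hm

end CentredRank

/-! ### Majorization and rearrangement -/

section Rearrangement

/-- If `φ` decreases with the rank `κ` and the sums of `a` over initial segments of `κ` are at most
those of `b`, then the same comparison holds for the sums weighted by `φ`. -/
theorem sum_mul_le_sum_mul_of_initial {α : Type*} [Fintype α] (κ φ a b : α → ℕ)
    (hφ : ∀ x y, κ x ≤ κ y → φ y ≤ φ x)
    (hab : ∀ n, ∑ x with κ x < n, a x ≤ ∑ x with κ x < n, b x) :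
    ∑ x, φ x * a x ≤ ∑ x, φ x * b x := by
  obtain ⟨K, hK⟩ : ∃ K, ∀ x, φ x ≤ K := ⟨univ.sup φ, fun x => le_sup (mem_univ x)⟩
  have layer (c : α → ℕ) : ∑ x, φ x * c x = ∑ u ∈ range K, ∑ x with u < φ x, c x := by
    simp only [sum_filter]
    rw [sum_comm]
    refine sum_congr rfl fun x _ => ?_
    rw [← sum_filter, sum_const, smul_eq_mul]
    congr 1
    have : {u ∈ range K | u < φ x} = range (φ x) := by
      ext u
      have := hK x
      simp only [mem_filter, mem_range]
      omega
    rw [this, card_range]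
  rw [layer, layer]
  refine sum_le_sum fun u _ => ?_
  -- Superlevel sets of φ are initial segments for κ.
  have hs : ({x | u < φ x} : Finset α) =
      ({x | κ x < ({x | u < φ x} : Finset α).sup fun x => κ x + 1} : Finset α) := by
    ext x
    simp only [mem_filter, mem_univ, true_and, Finset.lt_sup_iff]
    exact ⟨fun h => ⟨x, h, Nat.lt_succ_self _⟩,
      fun ⟨y, hy, hxy⟩ => hy.trans_le (hφ x y (Nat.lt_succ_iff.1 hxy))⟩
  rw [hs]
  exact hab _

variable {m : ℕ} [NeZero m]

/-- Every set has at most as much `f`-mass as the centred segment of its size has `g`-mass. -/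
def CentredMajorizes (g f : ZMod m → ℕ) : Prop :=
  ∀ D : Finset (ZMod m), ∑ x ∈ D, f x ≤ ∑ x ∈ initSeg m #D, g x

theorem exists_perm_centredDecreasing (hm : Odd m) (f : ZMod m → ℕ) :
    ∃ τ : Equiv.Perm (ZMod m), CentredDecreasing (f ∘ τ) := by
  let e := centredRankEquiv hm
  let F : Fin m → ℕᵒᵈ := fun i => OrderDual.toDual (f (e.symm i))
  refine ⟨(e.trans (Tuple.sort F)).trans e.symm, fun x y hxy => ?_⟩
  exact Tuple.monotone_sort F (show e x ≤ e y from hxy)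

theorem CentredMajorizes.sum_initSeg_comp_perm_le (hm : Odd m) {f g : ZMod m → ℕ}
    (h : CentredMajorizes g f) (τ : Equiv.Perm (ZMod m)) (n : ℕ) :
    ∑ x with centredRank x < n, f (τ x) ≤ ∑ x with centredRank x < n, g x := by
  change ∑ x ∈ initSeg m n, f (τ x) ≤ ∑ x ∈ initSeg m n, g x
  have hmin : initSeg m n = initSeg m (min n m) := by
    ext x
    have := centredRank_lt hm x
    simp only [mem_initSeg]
    omega
  have := h ((initSeg m n).map τ.toEmbedding)
  rwa [sum_map, card_map, hmin, card_initSeg hm (min_le_right _ _), ← hmin] at this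

/-- Once a permutation makes f decreasing, r can be replaced by r' with weight f, and then f by g
with weight r'. -/
theorem CentredMajorizes.sum_mul_le (hm : Odd m) {f g r r' : ZMod m → ℕ}
    (hf : CentredMajorizes g f) (hr : CentredMajorizes r' r) (hr' : CentredDecreasing r') :
    ∑ x, f x * r x ≤ ∑ x, g x * r' x := by
  obtain ⟨τ, hτ⟩ := exists_perm_centredDecreasing hm f
  calc ∑ x, f x * r x = ∑ x, f (τ x) * r (τ x) := (Equiv.sum_comp τ fun x => f x * r x).symm
    _ ≤ ∑ x, f (τ x) * r' x :=
      sum_mul_le_sum_mul_of_initial centredRank (f ∘ τ) (r ∘ τ) r' hτ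
        (hr.sum_initSeg_comp_perm_le hm τ)
    _ = ∑ x, r' x * f (τ x) := by simp only [mul_comm]
    _ ≤ ∑ x, r' x * g x :=
      sum_mul_le_sum_mul_of_initial centredRank r' (f ∘ τ) g hr'
        (hf.sum_initSeg_comp_perm_le hm τ)
    _ = _ := by simp only [mul_comm]

/-- Among all sets `C` of a given size and all sets `A` of odd size with generating differences,
representation counts are most concentrated for centred segments. -/
theorem centredMajorizes_repCount (hm : Odd m) {A : Finset (ZMod m)} {h : ℕ} (hA : #A = 2 * h + 1)
    (hgen : ∀ b ∈ A, ∀ c ∈ A, b ≠ c → AddSubgroup.zmultiples (c - b) = ⊤) (C : Finset (ZMod m)) :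
    CentredMajorizes (repCount (initSeg m #C) (initSeg m (2 * h + 1))) (repCount C A) := by
  intro D
  have hcard (E : Finset (ZMod m)) : #E ≤ m := by simpa [ZMod.card] using card_le_univ E
  have hA' : #(initSeg m (2 * h + 1)) = 2 * h + 1 := card_initSeg hm (hA ▸ hcard A)
  have hC' : #(initSeg m #C) = #C := card_initSeg hm (hcard C)
  have hD' : #(initSeg m #D) = #D := card_initSeg hm (hcard D)
  rcases D.eq_empty_or_nonempty with rfl | hD
  · simp
  have hD0 := card_pos.2 hD
  set r := repCount C A
  set r' := repCount (initSeg m #C) (initSeg m (2 * h + 1)) with hr'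
  have hdec : CentredDecreasing r' := centredDecreasing_repCount hm h #C
  obtain ⟨z, hz⟩ : ∃ z : ZMod m, centredRank z = #D - 1 := by
    refine ⟨(centredRankEquiv hm).symm ⟨#D - 1, by have := hcard D; omega⟩, ?_⟩
    exact congrArg Fin.val ((centredRankEquiv hm).apply_symm_apply _)
  -- The last value of r' on the segment of length #D: truncating r' at s flattens it to s on the
  -- segment and changes nothing outside, so the bound `hupper` for r becomes an equality for r'.
  set s := r' z with hs
  have hsC : s ≤ #C := hC' ▸ repCount_le_left _ _ z
  have hsA : s ≤ #A := by rw [hA, ← hA']; exact repCount_le_right _ _ z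
  have hsum : ∑ x, r x = ∑ x, r' x := by
    rw [sum_repCount, sum_repCount, hC', hA', hA]
  have hmin : ∑ x, min s (r' x) ≤ ∑ x, min s (r x) := by
    refine le_trans ?_ (pollard_min hgen hsC hsA)
    rw [ZMod.card]
    rcases le_total m (#C + #A - s) with hle | hle
    · rw [min_eq_left hle]
      refine (sum_le_sum fun x _ => min_le_left _ _).trans ?_
      simp [ZMod.card, mul_comm]
    · rw [min_eq_right hle, hA]
      have := sum_min_repCount_initSeg (s := s) hm (hcard C) (hA ▸ hcard A) ⟨h, rfl⟩
      rw [← hr'] at this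
      rw [hA] at hsA
      zify [hsC, hsA, show s ≤ #C + (2 * h + 1) by omega] at this ⊢
      nlinarith
  have hupper : ∑ x ∈ D, r x + ∑ x, min s (r x) ≤ #D * s + ∑ x, r x := by
    rw [← sum_add_sum_compl D (fun x => min s (r x)), ← sum_add_sum_compl D r, ← smul_eq_mul,
      ← sum_const]
    have h1 : ∑ x ∈ D, min s (r x) ≤ ∑ x ∈ D, s := sum_le_sum fun x _ => min_le_left _ _
    have h2 : ∑ x ∈ Dᶜ, min s (r x) ≤ ∑ x ∈ Dᶜ, r x := sum_le_sum fun x _ => min_le_right _ _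
    omega
  have hlower : #D * s + ∑ x, r' x ≤ ∑ x ∈ initSeg m #D, r' x + ∑ x, min s (r' x) := by
    nth_rw 1 [← hD']
    rw [← sum_add_sum_compl (initSeg m #D) (fun x => min s (r' x)),
      ← sum_add_sum_compl (initSeg m #D) r', ← smul_eq_mul, ← sum_const]
    have h1 : ∑ x ∈ initSeg m #D, s = ∑ x ∈ initSeg m #D, min s (r' x) :=
      sum_congr rfl fun x hx => (min_eq_left (hdec x z (by rw [mem_initSeg] at hx; omega))).symm
    have h2 : ∑ x ∈ (initSeg m #D)ᶜ, min s (r' x) = ∑ x ∈ (initSeg m #D)ᶜ, r' x :=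
      sum_congr rfl fun x hx =>
        min_eq_right (hdec z x (by rw [mem_compl, mem_initSeg] at hx; omega))
    omega
  omega

/-- Substituting x = y + a moves the shift from f onto the test set C, where
`centredMajorizes_repCount` applies. -/
theorem sum_shiftSum (A C : Finset (ZMod m)) (f : ZMod m → ℕ) :
    ∑ y ∈ C, shiftSum A f y = ∑ x, f x * repCount C A x := by
  simp only [shiftSum, repCount, card_filter, mul_sum]
  rw [sum_comm, sum_comm (s := univ)]
  refine sum_congr rfl fun a _ => ?_
  rw [← Equiv.sum_comp (Equiv.addRight a)]
  simp

theorem CentredMajorizes.shiftSum (hm : Odd m) {A : Finset (ZMod m)} {h : ℕ} (hA : #A = 2 * h + 1)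
    (hgen : ∀ b ∈ A, ∀ c ∈ A, b ≠ c → AddSubgroup.zmultiples (c - b) = ⊤) {f g : ZMod m → ℕ}
    (hfg : CentredMajorizes g f) :
    CentredMajorizes (shiftSum (initSeg m (2 * h + 1)) g) (shiftSum A f) := by
  intro C
  rw [sum_shiftSum, sum_shiftSum]
  exact hfg.sum_mul_le hm (centredMajorizes_repCount hm hA hgen C)
    (centredDecreasing_repCount hm h #C)

theorem centredMajorizes_indicator (hm : Odd m) (A : Finset (ZMod m)) :
    CentredMajorizes (fun x => if x ∈ initSeg m #A then 1 else 0)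
      (fun x => if x ∈ A then 1 else 0) := by
  intro D
  have hcard (E : Finset (ZMod m)) : #E ≤ m := by simpa [ZMod.card] using card_le_univ E
  rw [← card_filter, ← card_filter]
  have h1 : ({x ∈ initSeg m #D | x ∈ initSeg m #A} : Finset _) = initSeg m (min #D #A) := by
    ext x
    simp [mem_initSeg]
  rw [h1, card_initSeg hm ((min_le_left _ _).trans (hcard D))]
  exact le_min (card_filter_le _ _) (card_le_card fun x hx => (mem_filter.1 hx).2)

theorem sum_piFinset_eq_iterate_shiftSum {m : ℕ} (A : Finset (ZMod m)) (f : ZMod m → ℕ) (k : ℕ) :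
    ∀ y, ∑ a ∈ Fintype.piFinset (fun _ : Fin k => A), f (y + ∑ i, a i) = (shiftSum A)^[k] f y := by
  induction k with
  | zero => intro y; simp
  | succ k ih =>
    intro y
    rw [Function.iterate_succ_apply', shiftSum]
    simp only [← ih]
    rw [← sum_product']
    refine sum_nbij' (fun a => (a 0, fun i => a i.succ)) (fun u => Fin.cons u.1 u.2) ?_ ?_ ?_ ?_ ?_
    · intro a ha
      simp only [Fintype.mem_piFinset, mem_product] at *
      exact ⟨ha 0, fun i => ha i.succ⟩
    · rintro ⟨u, v⟩ huv
      simp only [Fintype.mem_piFinset, mem_product] at *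
      exact Fin.cases huv.1 huv.2
    · intro a _
      exact Fin.cons_self_tail a
    · rintro ⟨u, v⟩ _
      simp
    · intro a _
      simp [Fin.sum_univ_succ, add_assoc]

/-- Among sets of odd size with generating differences, the centred segment maximizes the number of
tuples of elements whose sum lies again in the set. -/
theorem card_filter_sum_mem_le (hm : Odd m) {A : Finset (ZMod m)} {h : ℕ} (hA : #A = 2 * h + 1)
    (hgen : ∀ b ∈ A, ∀ c ∈ A, b ≠ c → AddSubgroup.zmultiples (c - b) = ⊤) (k : ℕ) :
    #{a ∈ Fintype.piFinset (fun _ : Fin k => A) | ∑ i, a i ∈ A} ≤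
      #{a ∈ Fintype.piFinset (fun _ : Fin k => initSeg m (2 * h + 1)) |
        ∑ i, a i ∈ initSeg m (2 * h + 1)} := by
  have key : ∀ j, CentredMajorizes
      ((shiftSum (initSeg m (2 * h + 1)))^[j] fun x => if x ∈ initSeg m (2 * h + 1) then 1 else 0)
      ((shiftSum A)^[j] fun x => if x ∈ A then 1 else 0) := by
    intro j
    induction j with
    | zero => simpa [hA] using centredMajorizes_indicator hm A
    | succ j ih => simpa only [Function.iterate_succ_apply'] using ih.shiftSum hm hA hgen
  have hz : initSeg m 1 = {0} := by
    refine (eq_of_subset_of_card_le ?_ ?_).symm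
    · simp [mem_initSeg, centredRank]
    · rw [card_initSeg hm (NeZero.one_le), card_singleton]
  -- On {0} the majorization compares exactly the values at 0, that is, the two tuple counts.
  have := key k {0}
  rw [card_singleton, hz, sum_singleton, sum_singleton, ← sum_piFinset_eq_iterate_shiftSum,
    ← sum_piFinset_eq_iterate_shiftSum] at this
  simpa only [zero_add, card_filter] using this

end Rearrangement

/-! ### Digit sets and carries -/

section Carries

theorem balancedDigits_eq_initSeg {h : ℕ} [NeZero ((2 * h + 1) ^ 2)] :
    balancedDigits (2 * h + 1) = initSeg ((2 * h + 1) ^ 2) (2 * h + 1) := by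
  rw [initSeg_eq_image (Odd.pow ⟨h, rfl⟩) (Nat.le_self_pow two_ne_zero _), balancedDigits]
  congr 2 <;> push_cast <;> omega

/-- A difference that is nonzero modulo p is coprime to p², hence a unit, hence an additive
generator. -/
theorem IsDigitSet.zmultiples_sub_eq_top {p : ℕ} (hp : p.Prime) {A : Finset (ZMod (p ^ 2))}
    (hA : IsDigitSet p A) : ∀ b ∈ A, ∀ c ∈ A, b ≠ c → AddSubgroup.zmultiples (c - b) = ⊤ := by
  intro b hb c hc hbc
  have : NeZero (p ^ 2) := ⟨pow_ne_zero 2 hp.ne_zero⟩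
  have hu : IsUnit (c - b) := by
    have hne : ZMod.castHom (dvd_pow_self p two_ne_zero) (ZMod p) (c - b) ≠ 0 := by
      rw [map_sub, sub_ne_zero]
      exact fun h => hbc (hA.2 hb hc h.symm)
    rw [← ZMod.natCast_zmod_val (c - b)] at hne ⊢
    rw [ZMod.isUnit_iff_coprime]
    refine Nat.Coprime.pow_right 2 (Nat.Coprime.symm ((hp.coprime_iff_not_dvd).2 fun hd => hne ?_))
    rw [map_natCast]
    exact (ZMod.natCast_eq_zero_iff _ _).2 hd
  rw [AddSubgroup.eq_top_iff']
  intro x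
  obtain ⟨u, hu⟩ := hu
  rw [AddSubgroup.mem_zmultiples_iff]
  refine ⟨((x * (↑u⁻¹ : ZMod (p ^ 2))).val : ℤ), ?_⟩
  rw [zsmul_eq_mul, Int.cast_natCast, ZMod.natCast_zmod_val, ← hu, mul_assoc, Units.inv_mul,
    mul_one]

theorem isDigitSet_balancedDigits {p : ℕ} (hodd : Odd p) : IsDigitSet p (balancedDigits p) := by
  obtain ⟨h, rfl⟩ := hodd
  have : NeZero ((2 * h + 1) ^ 2) := ⟨by positivity⟩
  refine ⟨?_, ?_⟩
  · rw [balancedDigits_eq_initSeg,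
      card_initSeg (Odd.pow ⟨h, rfl⟩) (Nat.le_self_pow two_ne_zero _)]
  · intro x hx y hy hxy
    simp only [balancedDigits, coe_image, Set.mem_image, coe_Icc, Set.mem_Icc] at hx hy
    obtain ⟨u, hu, rfl⟩ := hx
    obtain ⟨v, hv, rfl⟩ := hy
    rw [map_intCast, map_intCast, ← sub_eq_zero, ← Int.cast_sub,
      ZMod.intCast_zmod_eq_zero_iff_dvd] at hxy
    have := Int.eq_zero_of_abs_lt_dvd hxy (by rw [abs_lt]; push_cast at *; omega)
    rw [sub_eq_zero.1 this]

theorem carryCount_add_card_filter {p : ℕ} (k : ℕ) (A : Finset (ZMod (p ^ 2))) :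
    #{a ∈ Fintype.piFinset (fun _ : Fin k => A) | ∑ i, a i ∈ A} + carryCount p k A = #A ^ k := by
  rw [carryCount, card_filter_add_card_filter_not, Fintype.card_piFinset_const]

theorem carryProb_eq_div {p : ℕ} (hp : p ≠ 0) (k : ℕ) (A : Finset (ZMod (p ^ 2))) :
    carryProb p k A = carryCount p k A / (#A : ENNReal) ^ k := by
  have : NeZero (p ^ 2) := ⟨pow_ne_zero 2 hp⟩
  have hset : {a : Fin k → ZMod (p ^ 2) | ∑ i, a i ∉ A} =
      (({a | ∑ i, a i ∉ A} : Finset (Fin k → ZMod (p ^ 2))) : Set (Fin k → ZMod (p ^ 2))) := by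
    ext; simp
  rw [carryProb, ← ProbabilityTheory.uniformOn_pi, ← Fintype.coe_piFinset, hset,
    ProbabilityTheory.uniformOn_apply_finset, carryCount, Fintype.card_piFinset_const, inter_filter,
    inter_univ]
  push_cast
  rfl

theorem carryCount_balancedDigits_le {p : ℕ} (hp : p.Prime) (hodd : Odd p) (k : ℕ)
    {A : Finset (ZMod (p ^ 2))} (hA : IsDigitSet p A) :
    carryCount p k (balancedDigits p) ≤ carryCount p k A := by
  have hgen := hA.zmultiples_sub_eq_top hp
  have h1 := carryCount_add_card_filter k A
  have h2 := carryCount_add_card_filter k (balancedDigits p)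
  rw [(isDigitSet_balancedDigits hodd).1] at h2
  rw [hA.1] at h1
  obtain ⟨h, rfl⟩ := hodd
  have : NeZero ((2 * h + 1) ^ 2) := ⟨by positivity⟩
  have := card_filter_sum_mem_le (Odd.pow ⟨h, rfl⟩) hA.1 hgen k
  rw [← balancedDigits_eq_initSeg] at this
  omega

end Carries

end

theorem corollary4p2 (p : ℕ) (hp : p.Prime) (hodd : Odd p) (k : ℕ) (hk : 0 < k) :
    (∀ A : Finset (ZMod (p ^ 2)), IsDigitSet p A →
      carryCount p k (balancedDigits p) ≤ carryCount p k A) ∧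
    IsLeast {q : ENNReal | ∃ A : Finset (ZMod (p ^ 2)), IsDigitSet p A ∧ carryProb p k A = q}
      (carryProb p k (balancedDigits p)) := by
  have hcount (A : Finset (ZMod (p ^ 2))) (hA : IsDigitSet p A) :=
    carryCount_balancedDigits_le hp hodd k hA
  have hbal := isDigitSet_balancedDigits hodd
  refine ⟨hcount, ⟨_, hbal, rfl⟩, ?_⟩
  rintro _ ⟨A, hA, rfl⟩
  rw [carryProb_eq_div hp.ne_zero, carryProb_eq_div hp.ne_zero, hA.1, hbal.1]
  gcongr
  exact hcount A hA
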